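/- Let $\mathbb F$ be an algebraically closed field, and let $n,r\ge 0$ be integers. The slice rank $\operatorname{srk}(T)$ of $T\in U\otimes V\otimes W$ is the smallest $k\ge 0$ such that $T$ is a linear combination of $k$ tensors, each of one of the forms $u\otimes_1 X$, $v\otimes_2 Y$, $w\otimes_3 Z$ with $u\in U$, $X\in V\otimes W$, $v\in V$, $Y\in U\otimes W$, $w\in W$, $Z\in U\otimes V$ (where $\otimes_j$ inserts the vector as the $j$-th tensor factor). Put $\mathcal{SV}_{U\otimes V\otimes W,r}=\{T\in U\otimes V\otimes W:\operatorname{srk}(T)\le r\}$. For every triple $\rho=(r_1,r_2,r_3)$ of non-negative integers with $r_1+r_2+r_3=r$ let $$U'_\rho=\mathbb F^{r_1}\oplus(\mathbb F^n)^{\oplus r_2}\oplus(\mathbb F^n)^{\oplus r_3},\quad V'_\rho=(\mathbb F^n)^{\oplus r_1}\oplus\mathbb F^{r_2}\oplus(\mathbb F^n)^{\oplus r_3},\quad W'_\rho=(\mathbb F^n)^{\oplus r_1}\oplus(\mathbb F^n)^{\oplus r_2}\oplus\mathbb F^{r_3},$$ of dimensions $s_1=r_1+nr_2+nr_3$, $s_2=nr_1+r_2+nr_3$,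 $s_3=nr_1+nr_2+r_3$. Let $e^k_i$ $(i\le r_k)$ be the standard basis of the summand $\mathbb F^{r_k}$ and $e^k_{ij}$ $(i\le r_k,\ j\le n)$ that of each summand $(\mathbb F^n)^{\oplus r_k}$, and let the unit slice rank tensor $S_{n,r_1,r_2,r_3}\in U'_\rho\otimes V'_\rho\otimes W'_\rho$ be $$S_{n,r_1,r_2,r_3}=\sum_{i=1}^{r_1}\sum_{j=1}^n e^1_i\otimes e^1_{ij}\otimes e^1_{ij}+\sum_{i=1}^{r_2}\sum_{j=1}^n e^2_{ij}\otimes e^2_i\otimes e^2_{ij}+\sum_{i=1}^{r_3}\sum_{j=1}^n e^3_{ij}\otimes e^3_{ij}\otimes e^3_i .$$ Let $U,V,W$ be $n$-dimensional $\mathbb F$-vector spaces. For every $\rho$ let $A_\rho,B_\rho,C_\rho$ be finite-dimensional vector spaces containing $U'_\rho,V'_\rho,W'_\rho$, respectively, as well as $U,V,W$, respectively, as subspaces (given by arbitrary linear embeddings). Then $$\mathcal{SV}_{U\otimes V\otimes W,r}=\bigcup_{r_1+r_2+r_3=r}\overline{\bigl(\mathsf{GL}(A_\rho)\times\mathsf{GL}(B_\rho)\times\mathsf{GL}(C_\rho)\bigr)\,S_{n,r_1,r_2,r_3}}\;\cap\;(U\otimes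 V\otimes W),$$ where the closure is the Zariski closure in $A_\rho\otimes B_\rho\otimes C_\rho$. In particular, for every $\rho$ with $s_1,s_2,s_3\ge n$ one may take $A_\rho=U'_\rho$, $B_\rho=V'_\rho$, $C_\rho=W'_\rho$, so that the group is $\mathsf{GL}_{s_1}\times\mathsf{GL}_{s_2}\times\mathsf{GL}_{s_3}$. -/

import Mathlib

open scoped TensorProduct

noncomputable section

namespace SliceRank

/-- The first tensor product `⊗₁ : U × (V ⊗ W) → U ⊗ V ⊗ W`. -/
def otimes₁ {F U V W : Type*} [Field F] [AddCommGroup U] [Module F U] [AddCommGroup V]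
    [Module F V] [AddCommGroup W] [Module F W] (u : U) (x : V ⊗[F] W) : U ⊗[F] (V ⊗[F] W) :=
  u ⊗ₜ[F] x

/-- The second tensor product `⊗₂ : V × (U ⊗ W) → U ⊗ V ⊗ W`, `v ⊗₂ (u ⊗ w) = u ⊗ v ⊗ w`. -/
def otimes₂ {F U V W : Type*} [Field F] [AddCommGroup U] [Module F U] [AddCommGroup V]
    [Module F V] [AddCommGroup W] [Module F W] (v : V) (y : U ⊗[F] W) : U ⊗[F] (V ⊗[F] W) :=
  TensorProduct.leftComm F V U W (v ⊗ₜ[F] y)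

/-- The third tensor product `⊗₃ : W × (U ⊗ V) → U ⊗ V ⊗ W`, `w ⊗₃ (u ⊗ v) = u ⊗ v ⊗ w`. -/
def otimes₃ {F U V W : Type*} [Field F] [AddCommGroup U] [Module F U] [AddCommGroup V]
    [Module F V] [AddCommGroup W] [Module F W] (w : W) (z : U ⊗[F] V) : U ⊗[F] (V ⊗[F] W) :=
  TensorProduct.assoc F U V W (z ⊗ₜ[F] w)

section Rank

variable {F U V W : Type*} [Field F] [AddCommGroup U] [Module F U]
  [AddCommGroup V] [Module F V] [AddCommGroup W] [Module F W]

/-- The building blocks of slice rank: tensors `v_j ⊗_j x` with `v_j` a vector in the `j`-th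
factor and `x` in the tensor product of the two other factors. -/
def IsSlice (T : U ⊗[F] (V ⊗[F] W)) : Prop :=
  (∃ (u : U) (x : V ⊗[F] W), T = otimes₁ u x) ∨
  (∃ (v : V) (y : U ⊗[F] W), T = otimes₂ v y) ∨
  (∃ (w : W) (z : U ⊗[F] V), T = otimes₃ w z)

/-- `T` is a linear combination of `k` slices. -/
def IsCombOfSlices (T : U ⊗[F] (V ⊗[F] W)) (k : ℕ) : Prop :=
  ∃ (c : Fin k → F) (t : Fin k → U ⊗[F] (V ⊗[F] W)),
    (∀ i, IsSlice (t i)) ∧ T = ∑ i, c i • t i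

/-- The slice rank: the least `k` such that `T` is a linear combination of `k` slices
(such a `k` exists by `exists_isCombOfSlices`). -/
def sliceRank (T : U ⊗[F] (V ⊗[F] W)) : ℕ :=
  sInf {k | IsCombOfSlices T k}

theorem exists_isCombOfSlices (T : U ⊗[F] (V ⊗[F] W)) : ∃ k, IsCombOfSlices T k := by
  induction T using TensorProduct.induction_on with
  | zero => exact ⟨0, 0, 0, fun i => i.elim0, by simp⟩
  | tmul u x => exact ⟨1, fun _ => 1, fun _ => u ⊗ₜ x, fun _ => Or.inl ⟨u, x, rfl⟩, by simp⟩
  | add S T hS hT =>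
    obtain ⟨k, c, s, hs, rfl⟩ := hS
    obtain ⟨l, d, t, ht, rfl⟩ := hT
    refine ⟨k + l, Fin.append c d, Fin.append s t, fun i => ?_, ?_⟩
    · refine Fin.addCases (fun j => ?_) (fun j => ?_) i
      · simpa using hs j
      · simpa using ht j
    · simp [Fin.sum_univ_add]

end Rank

/-- The slice rank variety `{T ∈ U ⊗ V ⊗ W : srk T ≤ r}`. -/
def sliceRankVariety (F U V W : Type*) [Field F] [AddCommGroup U] [Module F U]
    [AddCommGroup V] [Module F V] [AddCommGroup W] [Module F W] (r : ℕ) :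
    Set (U ⊗[F] (V ⊗[F] W)) :=
  {T | sliceRank T ≤ r}

/-- The Zariski closure of a subset of a (finite-dimensional) vector space `M`: the common zeros
of all polynomial functions on `M` that vanish on the set. A polynomial function on `M` is a
polynomial expression in linear forms on `M`. -/
def zariskiClosure (F : Type*) {M : Type*} [Field F] [AddCommGroup M] [Module F M]
    (X : Set M) : Set M :=
  {x | ∀ p : MvPolynomial (Module.Dual F M) F,
    (∀ y ∈ X, MvPolynomial.eval (fun φ => φ y) p = 0) → MvPolynomial.eval (fun φ => φ x) p = 0}

/-- The orbit of `T` under the natural action of `GL(A) × GL(B) × GL(C)` on `A ⊗ B ⊗ C`. -/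
def orbit {F A B C : Type*} [Field F] [AddCommGroup A] [Module F A] [AddCommGroup B] [Module F B]
    [AddCommGroup C] [Module F C] (T : A ⊗[F] (B ⊗[F] C)) : Set (A ⊗[F] (B ⊗[F] C)) :=
  {T' | ∃ (a : LinearMap.GeneralLinearGroup F A) (b : LinearMap.GeneralLinearGroup F B)
    (c : LinearMap.GeneralLinearGroup F C),
    T' = TensorProduct.map (a : A →ₗ[F] A)
      (TensorProduct.map (b : B →ₗ[F] B) (c : C →ₗ[F] C)) T}

/-- Triples `(r₁, r₂, r₃)` of natural numbers with `r₁ + r₂ + r₃ = r`. -/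
structure Triple (r : ℕ) where
  r₁ : ℕ
  r₂ : ℕ
  r₃ : ℕ
  sum_eq : r₁ + r₂ + r₃ = r

/-- `U' = F^{r₁} ⊕ (F^n)^{r₂} ⊕ (F^n)^{r₃}`, of dimension `s₁ = r₁ + n r₂ + n r₃`. -/
abbrev U' (F : Type*) (n : ℕ) {r : ℕ} (ρ : Triple r) : Type _ :=
  Fin ρ.r₁ ⊕ (Fin ρ.r₂ × Fin n) ⊕ (Fin ρ.r₃ × Fin n) → F

/-- `V' = (F^n)^{r₁} ⊕ F^{r₂} ⊕ (F^n)^{r₃}`, of dimension `s₂ = n r₁ + r₂ + n r₃`. -/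
abbrev V' (F : Type*) (n : ℕ) {r : ℕ} (ρ : Triple r) : Type _ :=
  (Fin ρ.r₁ × Fin n) ⊕ Fin ρ.r₂ ⊕ (Fin ρ.r₃ × Fin n) → F

/-- `W' = (F^n)^{r₁} ⊕ (F^n)^{r₂} ⊕ F^{r₃}`, of dimension `s₃ = n r₁ + n r₂ + r₃`. -/
abbrev W' (F : Type*) (n : ℕ) {r : ℕ} (ρ : Triple r) : Type _ :=
  (Fin ρ.r₁ × Fin n) ⊕ (Fin ρ.r₂ × Fin n) ⊕ Fin ρ.r₃ → F

/-- A standard basis vector of `ι → F`. -/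
abbrev e (F : Type*) [Field F] {ι : Type*} [DecidableEq ι] (i : ι) : ι → F := Pi.single i 1

/-- The unit slice rank tensor `S_{n, r₁, r₂, r₃} ∈ U' ⊗ V' ⊗ W'`. -/
def unitTensor (F : Type*) [Field F] (n : ℕ) {r : ℕ} (ρ : Triple r) :
    U' F n ρ ⊗[F] (V' F n ρ ⊗[F] W' F n ρ) :=
  (∑ i : Fin ρ.r₁, ∑ j : Fin n,
      e F (.inl i) ⊗ₜ[F] (e F (.inl (i, j)) ⊗ₜ[F] e F (.inl (i, j)))) +
  (∑ i : Fin ρ.r₂, ∑ j : Fin n,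
      e F (.inr (.inl (i, j))) ⊗ₜ[F] (e F (.inr (.inl i)) ⊗ₜ[F] e F (.inr (.inl (i, j))))) +
  (∑ i : Fin ρ.r₃, ∑ j : Fin n,
      e F (.inr (.inr (i, j))) ⊗ₜ[F] (e F (.inr (.inr (i, j))) ⊗ₜ[F] e F (.inr (.inr i))))

end SliceRank

end

/-!
By definition `srk T ≤ r` means that `T` is a sum of `r₁`, `r₂` and `r₃` slices in the three
directions for some `r₁ + r₂ + r₃ = r`, so it suffices to treat each `ρ = (r₁, r₂, r₃)` separately.

Such slice sums are closed. By the valuative criterion, it is enough that a slice sum over a valued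
field `K` all of whose entries lie in the valuation ring `O` is a slice sum over `O`: one may then
reduce it to the residue field and descend to `F` by the Nullstellensatz. Dividing a vector over
`K` by a coordinate of maximal valuation, one sees that any `p` vectors are annihilated by some
`1 - M N` with `M`, `N` integral of inner dimension `p`. Three such matrices annihilate the slice
sum, and expanding `(1 - M₁ N₁) ⊗ (1 - M₂ N₂) ⊗ (1 - M₃ N₃) T = 0` writes `T` as an integral slice
sum.

Conversely, a matrix in `V ⊗ W` has rank at most `n`, so every slice sum is the image of the unit
tensor under linear maps. These factor through finite-dimensional spaces, so `f - t` is invertible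
for almost all `t`, and `f`, `g`, `h` can be replaced by invertible maps one factor at a time
without leaving the closure of the orbit.
-/

namespace SliceRank

section ZariskiClosure

open MvPolynomial

variable {F M N : Type*} [Field F] [AddCommGroup M] [Module F M] [AddCommGroup N] [Module F N]
  {X Y : Set M}

theorem zariskiClosure_mono (h : X ⊆ Y) : zariskiClosure F X ⊆ zariskiClosure F Y :=
  fun _ hx p hp => hx p fun y hy => hp y (h hy)

theorem subset_zariskiClosure : X ⊆ zariskiClosure F X :=
  fun x hx _ hp => hp x hx

theorem map_mem_zariskiClosure_image (L : M →ₗ[F] N) {x : M} (hx : x ∈ zariskiClosure F X) :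
    L x ∈ zariskiClosure F (L '' X) := by
  intro p hp
  have h := hx (rename (fun φ => φ ∘ₗ L) p) fun y hy => by
    rw [eval_rename]
    exact hp (L y) ⟨y, hy, rfl⟩
  rwa [eval_rename] at h

theorem mem_zariskiClosure_of_infinite_line {x y : M}
    (h : {t : F | x + t • y ∈ zariskiClosure F X}.Infinite) : x ∈ zariskiClosure F X := by
  intro p hp
  let P : Polynomial F := aeval (fun φ : Module.Dual F M =>
    Polynomial.C (φ x) + Polynomial.C (φ y) * Polynomial.X) p
  have eval_P (t : F) : P.eval t = eval (fun φ : Module.Dual F M => φ (x + t • y)) p := by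
    rw [← Polynomial.coe_aeval_eq_eval, comp_aeval_apply, ← MvPolynomial.coe_aeval_eq_eval]
    simp only [map_add, map_smul, map_mul, smul_eq_mul, Polynomial.aeval_C, Polynomial.aeval_X,
      Algebra.algebraMap_self, RingHom.id_apply, mul_comm t]
    rfl
  have hP : P = 0 := Polynomial.eq_zero_of_infinite_isRoot P <| h.mono fun t ht => by
    exact (eval_P t).trans (ht p hp)
  simpa [hP] using (eval_P 0).symm

theorem eval_eq_zero_of_mem_zariskiClosure {ι : Type*} {X : Set (ι → F)} {x : ι → F}
    (hx : x ∈ zariskiClosure F X) {p : MvPolynomial ι F} (hp : ∀ y ∈ X, eval y p = 0) :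
    eval x p = 0 := by
  have h := hx (rename LinearMap.proj p) fun y hy => by
    rw [eval_rename]
    exact hp y hy
  rwa [eval_rename] at h

end ZariskiClosure

section ValuativeCriterion

open MvPolynomial

universe u v

theorem exists_eval_eq_of_aeval_eq_algebraMap {F k σ ι : Type*} [Field F] [IsAlgClosed F]
    [CommRing k] [Nontrivial k] [Algebra F k] [Finite σ] {G : ι → MvPolynomial σ F} {t : ι → F}
    {z : σ → k} (h : ∀ i, aeval z (G i) = algebraMap F k (t i)) :
    ∃ x : σ → F, ∀ i, eval x (G i) = t i := by
  obtain ⟨m, hm, hle⟩ := Ideal.exists_le_maximal _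
    (RingHom.ker_ne_top (aeval z : MvPolynomial σ F →ₐ[F] k))
  obtain ⟨x, rfl⟩ := isMaximal_iff_eq_vanishingIdeal_singleton.mp hm
  refine ⟨x, fun i => ?_⟩
  have hker : G i - C (t i) ∈ RingHom.ker (aeval z : MvPolynomial σ F →ₐ[F] k) := by
    simp [RingHom.mem_ker, h]
  simpa [mem_vanishingIdeal_singleton_iff, sub_eq_zero] using hle hker

theorem exists_valuationSubring_of_specialization {F K ι : Type*} [Field F] [Field K]
    [Algebra F K] {x : ι → K} {t : ι → F}
    (h : ∀ p : MvPolynomial ι F, aeval x p = 0 → eval t p = 0) :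
    ∃ (O : ValuationSubring K) (_ : Algebra F O) (_ : IsScalarTower F O K) (y : ι → O),
      (∀ i, (y i : K) = x i) ∧
        ∀ i, IsLocalRing.residue O (y i) = algebraMap F (IsLocalRing.ResidueField O) (t i) := by
  -- A valuation ring of `K` dominating the image of the local ring of affine space at `t`.
  let m : Ideal (MvPolynomial ι F) := RingHom.ker (eval t)
  have : m.IsPrime := RingHom.ker_isPrime (eval t)
  let φ : Localization.AtPrime m →+* K := IsLocalization.lift (M := m.primeCompl)
    (g := (aeval x : MvPolynomial ι F →ₐ[F] K).toRingHom) fun p =>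
      isUnit_iff_ne_zero.mpr (mt (h p) p.2)
  have φ_apply (p) : φ (algebraMap _ _ p) = aeval x p := IsLocalization.lift_eq _ p
  obtain ⟨O, hO, hlocal⟩ := IsLocalRing.exists_factor_valuationRing φ
  let ψ : Localization.AtPrime m →+* O := φ.codRestrict O.toSubring hO
  have : IsLocalHom ψ := hlocal
  let θ : MvPolynomial ι F →+* O := ψ.comp (algebraMap _ _)
  have coe_θ (p) : (θ p : K) = aeval x p := φ_apply p
  have residue_θ {p} (hp : p ∈ m) : IsLocalRing.residue O (θ p) = 0 := by
    rw [IsLocalRing.residue_eq_zero_iff]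
    have hp' := (IsLocalization.AtPrime.to_map_mem_maximal_iff (Localization.AtPrime m) m p).mpr hp
    exact map_nonunit ψ _ hp'
  let _ : Algebra F O := (θ.comp C).toAlgebra
  refine ⟨O, inferInstance, .of_algebraMap_eq fun c => ?_, fun i => θ (X i), fun i => ?_,
    fun i => ?_⟩
  · exact ((coe_θ (C c)).trans (aeval_C x c)).symm
  · rw [coe_θ, aeval_X]
  · have := residue_θ (p := X i - C (t i)) (by simp [m, RingHom.mem_ker])
    rwa [map_sub, map_sub, sub_eq_zero] at this

theorem zariskiClosure_range_subset_of_valuative {F : Type u} [Field F] [IsAlgClosed F]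
    {σ : Type v} [Finite σ] {ι : Type*} (G : ι → MvPolynomial σ F)
    (lift : ∀ (K : Type (max u v)) [Field K] [Algebra F K] (O : ValuationSubring K) [Algebra F O]
      [IsScalarTower F O K] (x : σ → K) (y : ι → O), (∀ i, aeval x (G i) = (y i : K)) →
        ∃ x' : σ → O, ∀ i, aeval x' (G i) = y i) :
    zariskiClosure F (Set.range fun (z : σ → F) i => eval z (G i)) ⊆
      Set.range fun (z : σ → F) i => eval z (G i) := by
  intro t ht
  -- Compare `t` with the generic point of the closure of the image.
  let K := FractionRing (MvPolynomial σ F)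
  obtain ⟨O, _, _, y, hy, residue_y⟩ := exists_valuationSubring_of_specialization
    (x := algebraMap (MvPolynomial σ F) K ∘ G) (t := t) fun p hp => by
      rw [aeval_algebraMap_apply, FaithfulSMul.algebraMap_eq_zero_iff] at hp
      refine eval_eq_zero_of_mem_zariskiClosure ht ?_
      rintro _ ⟨z, rfl⟩
      have hz := congrArg (aeval z : MvPolynomial σ F →ₐ[F] F) hp
      rwa [map_zero, comp_aeval_apply] at hz
  obtain ⟨x, hx⟩ := lift K O (algebraMap (MvPolynomial σ F) K ∘ X) y fun i => by
    rw [hy, aeval_algebraMap_apply, aeval_X_left_apply, Function.comp_apply]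
  obtain ⟨z, hz⟩ := exists_eval_eq_of_aeval_eq_algebraMap (G := G) (t := t)
    (z := IsLocalRing.residue O ∘ x) fun i => by
      rw [← residue_y, ← hx]
      exact aeval_algebraMap_apply (IsLocalRing.ResidueField O) x (G i)
  exact ⟨z, funext hz⟩

end ValuativeCriterion

section Arrays

open Matrix

/-- The index set of the entries of the vectors `u t`, `v t`, `w t` and the matrices `X t`, `Y t`,
`Z t` that parametrize the sums of `p`, `q` and `s` slices in the three directions; slice sums are
thereby a polynomial map from an affine space, to which the valuative criterion applies. -/
abbrev SliceParam (p q s : ℕ) (a b c : Type*) : Type _ :=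
  Fin p × (a ⊕ b × c) ⊕ Fin q × (b ⊕ a × c) ⊕ Fin s × (c ⊕ a × b)

variable {R S a b c : Type*} [CommRing R] [CommRing S] {p q s : ℕ}

/-- The array `∑ u ⊗₁ X + ∑ v ⊗₂ Y + ∑ w ⊗₃ Z` whose vectors and matrices have the entries `z`, over
any commutative ring: the coordinate form of `IsSliceSum`. -/
def sliceSum (z : SliceParam p q s a b c → R) (i : a × b × c) : R :=
  ∑ t, z (.inl (t, .inl i.1)) * z (.inl (t, .inr i.2)) +
    ∑ t, z (.inr (.inl (t, .inl i.2.1))) * z (.inr (.inl (t, .inr (i.1, i.2.2)))) +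
    ∑ t, z (.inr (.inr (t, .inl i.2.2))) * z (.inr (.inr (t, .inr (i.1, i.2.1))))

theorem map_sliceSum (φ : R →+* S) (z : SliceParam p q s a b c → R) (i : a × b × c) :
    φ (sliceSum z i) = sliceSum (φ ∘ z) i := by
  simp only [sliceSum, map_add, map_sum, map_mul, Function.comp_apply]

theorem aeval_sliceSum_X [Algebra R S] (z : SliceParam p q s a b c → S) (i : a × b × c) :
    MvPolynomial.aeval z (sliceSum (MvPolynomial.X (R := R)) i) = sliceSum z i := by
  refine (map_sliceSum (MvPolynomial.aeval z : _ →ₐ[R] S).toRingHom _ i).trans ?_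
  congr 1
  exact funext fun t => MvPolynomial.aeval_X z t

section Contract

variable [Fintype a] [Fintype b] [Fintype c]

/-- The action of three square matrices on three-dimensional arrays, one in each direction. A slice
sum vanishes under matrices that annihilate its vectors. -/
def contract (P : Matrix a a R) (Q : Matrix b b R) (M : Matrix c c R) :
    (a × b × c → R) →ₗ[R] (a × b × c → R) where
  toFun T i := ∑ i', P i.1 i' * ∑ j', Q i.2.1 j' * ∑ k', M i.2.2 k' * T (i', j', k')
  map_add' T T' := by
    funext i
    simp only [Pi.add_apply, mul_add, Finset.sum_add_distrib]
  map_smul' r T := by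
    funext i
    simp only [Pi.smul_apply, smul_eq_mul, RingHom.id_apply, Finset.mul_sum, mul_left_comm r]

theorem map_contract (φ : R →+* S) (P : Matrix a a R) (Q : Matrix b b R) (M : Matrix c c R)
    (T : a × b × c → R) (i : a × b × c) :
    φ (contract P Q M T i) = contract (P.map φ) (Q.map φ) (M.map φ) (φ ∘ T) i := by
  simp only [contract, LinearMap.coe_mk, AddHom.coe_mk, map_sum, map_mul, map_apply,
    Function.comp_apply]

variable {P : Matrix a a R} {Q : Matrix b b R} {M : Matrix c c R}

theorem contract_slice₁_eq_zero {u : a → R} (hu : P *ᵥ u = 0) (x : b × c → R) :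
    contract P Q M (fun i => u i.1 * x i.2) = 0 := by
  funext i
  calc contract P Q M (fun i => u i.1 * x i.2) i
      = (P *ᵥ u) i.1 * ∑ j', Q i.2.1 j' * ∑ k', M i.2.2 k' * x (j', k') := by
        simp only [contract, LinearMap.coe_mk, AddHom.coe_mk, mulVec, dotProduct,
          mul_left_comm _ (u _), ← Finset.mul_sum, Finset.sum_mul, mul_assoc]
    _ = 0 := by rw [hu, Pi.zero_apply, zero_mul]

theorem contract_slice₂_eq_zero {v : b → R} (hv : Q *ᵥ v = 0) (y : a × c → R) :
    contract P Q M (fun i => v i.2.1 * y (i.1, i.2.2)) = 0 := by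
  funext i
  calc contract P Q M (fun i => v i.2.1 * y (i.1, i.2.2)) i
      = ∑ i', P i.1 i' * ((Q *ᵥ v) i.2.1 * ∑ k', M i.2.2 k' * y (i', k')) := by
        simp only [contract, LinearMap.coe_mk, AddHom.coe_mk, mulVec, dotProduct,
          mul_left_comm _ (v _), ← Finset.mul_sum, Finset.sum_mul, mul_assoc]
    _ = 0 := by simp only [hv, Pi.zero_apply, zero_mul, mul_zero, Finset.sum_const_zero]

theorem contract_slice₃_eq_zero {w : c → R} (hw : M *ᵥ w = 0) (z : a × b → R) :
    contract P Q M (fun i => w i.2.2 * z (i.1, i.2.1)) = 0 := by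
  funext i
  calc contract P Q M (fun i => w i.2.2 * z (i.1, i.2.1)) i
      = ∑ i', P i.1 i' * ∑ j', Q i.2.1 j' * ((M *ᵥ w) i.2.2 * z (i', j')) := by
        simp only [contract, LinearMap.coe_mk, AddHom.coe_mk, mulVec, dotProduct,
          Finset.sum_mul, mul_assoc]
    _ = 0 := by simp only [hw, Pi.zero_apply, zero_mul, mul_zero, Finset.sum_const_zero]

theorem contract_sliceSum_eq_zero {z : SliceParam p q s a b c → R}
    (hP : ∀ t, (P *ᵥ fun i => z (.inl (t, .inl i))) = 0)
    (hQ : ∀ t, (Q *ᵥ fun j => z (.inr (.inl (t, .inl j)))) = 0)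
    (hM : ∀ t, (M *ᵥ fun k => z (.inr (.inr (t, .inl k)))) = 0) :
    contract P Q M (sliceSum z) = 0 := by
  have h : sliceSum z = ∑ t, (fun i : a × b × c => z (.inl (t, .inl i.1)) * z (.inl (t, .inr i.2)))
      + ∑ t, (fun i : a × b × c =>
        z (.inr (.inl (t, .inl i.2.1))) * z (.inr (.inl (t, .inr (i.1, i.2.2)))))
      + ∑ t, (fun i : a × b × c =>
        z (.inr (.inr (t, .inl i.2.2))) * z (.inr (.inr (t, .inr (i.1, i.2.1))))) := by
    funext i
    simp only [sliceSum, Pi.add_apply, Finset.sum_apply]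
  simp only [h, map_add, map_sum,
    fun t => contract_slice₁_eq_zero (Q := Q) (M := M) (hP t) fun jk => z (.inl (t, .inr jk)),
    fun t => contract_slice₂_eq_zero (P := P) (M := M) (hQ t)
      fun ik => z (.inr (.inl (t, .inr ik))),
    fun t => contract_slice₃_eq_zero (P := P) (Q := Q) (hM t)
      fun ij => z (.inr (.inr (t, .inr ij))),
    Finset.sum_const_zero, add_zero]

theorem exists_sliceSum_eq_of_contract_eq_zero [DecidableEq a] [DecidableEq b] [DecidableEq c]
    {M₁ : Matrix a (Fin p) R} {N₁ : Matrix (Fin p) a R} {M₂ : Matrix b (Fin q) R}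
    {N₂ : Matrix (Fin q) b R} {M₃ : Matrix c (Fin s) R} {N₃ : Matrix (Fin s) c R}
    {T : a × b × c → R} (h : contract (1 - M₁ * N₁) (1 - M₂ * N₂) (1 - M₃ * N₃) T = 0) :
    ∃ z : SliceParam p q s a b c → R, sliceSum z = T := by
  -- `T = M₃ N₃ T + M₂ N₂ T' + M₁ N₁ T''`, where `T'` and `T''` are the successive remainders.
  let T' : a × b × c → R := fun i => ((1 - M₃ * N₃) *ᵥ fun k => T (i.1, i.2.1, k)) i.2.2
  let T'' : a × b × c → R := fun i => ((1 - M₂ * N₂) *ᵥ fun j => T' (i.1, j, i.2.2)) i.2.1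
  refine ⟨fun
    | .inl (t, .inl i) => M₁ i t
    | .inl (t, .inr jk) => (N₁ *ᵥ fun i => T'' (i, jk)) t
    | .inr (.inl (t, .inl j)) => M₂ j t
    | .inr (.inl (t, .inr (i, k))) => (N₂ *ᵥ fun j => T' (i, j, k)) t
    | .inr (.inr (t, .inl k)) => M₃ k t
    | .inr (.inr (t, .inr (i, j))) => (N₃ *ᵥ fun k => T (i, j, k)) t, ?_⟩
  funext ⟨i, j, k⟩
  have h₁ : ((1 - M₁ * N₁) *ᵥ fun i => T'' (i, j, k)) i = 0 := congrFun h (i, j, k)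
  have h₂ : ((1 - M₂ * N₂) *ᵥ fun j => T' (i, j, k)) j = T'' (i, j, k) := rfl
  have h₃ : ((1 - M₃ * N₃) *ᵥ fun k => T (i, j, k)) k = T' (i, j, k) := rfl
  rw [sub_mulVec, one_mulVec, Pi.sub_apply, ← mulVec_mulVec] at h₁ h₂ h₃
  change (M₁ *ᵥ (N₁ *ᵥ fun i => T'' (i, j, k))) i + (M₂ *ᵥ (N₂ *ᵥ fun j => T' (i, j, k))) j +
    (M₃ *ᵥ (N₃ *ᵥ fun k => T (i, j, k))) k = T (i, j, k)
  linear_combination -h₁ - h₂ - h₃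

end Contract

section ValuationRing

variable {O K : Type*} [CommRing O] [IsDomain O] [ValuationRing O] [Field K] [Algebra O K]
  [IsFractionRing O K]

theorem exists_map_vecMulVec_mulVec_eq_self [Fintype a] (w : a → K) :
    ∃ x y : a → O, (vecMulVec x y).map (algebraMap O K) *ᵥ w = w := by
  classical
  rcases isEmpty_or_nonempty a with _ | _
  · exact ⟨0, 0, Subsingleton.elim _ _⟩
  -- Divide `w` by a coordinate of maximal valuation.
  obtain ⟨i, hi⟩ := Finite.exists_max fun j => ValuationRing.valuation O K (w j)
  choose x hx using hi
  refine ⟨x, Pi.single i 1, funext fun j => ?_⟩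
  rw [mulVec, dotProduct, Finset.sum_eq_single i (fun l _ hl => by simp [vecMulVec_apply, hl])
    (by simp), map_apply, vecMulVec_apply, Pi.single_eq_same, mul_one, ← Algebra.smul_def, hx]

theorem exists_map_one_sub_mul_mulVec_eq_zero [Fintype a] [DecidableEq a]
    (u : Fin p → a → K) :
    ∃ (M : Matrix a (Fin p) O) (N : Matrix (Fin p) a O),
      ∀ t, (1 - M * N).map (algebraMap O K) *ᵥ u t = 0 := by
  induction p with
  | zero => exact ⟨0, 0, fun t => t.elim0⟩
  | succ p ih =>
    obtain ⟨M, N, h⟩ := ih fun t => u t.castSucc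
    obtain ⟨x, y, hxy⟩ := exists_map_vecMulVec_mulVec_eq_self (O := O)
      ((1 - M * N).map (algebraMap O K) *ᵥ u (Fin.last p))
    let M' : Matrix a (Fin (p + 1)) O := .of fun i => Fin.snoc (M i) (x i)
    let N' : Matrix (Fin (p + 1)) a O := .of (Fin.snoc (fun t => N t) (y ᵥ* (1 - M * N)))
    have factor : 1 - M' * N' = (1 - vecMulVec x y) * (1 - M * N) := by
      rw [sub_mul, one_mul, vecMulVec_mul, sub_sub]
      congr 1
      ext i j
      simp [M', N', Matrix.mul_apply, Fin.sum_univ_castSucc, vecMulVec_apply]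
    refine ⟨M', N', fun t => ?_⟩
    rw [factor, Matrix.map_mul, ← mulVec_mulVec]
    cases t using Fin.lastCases with
    | last => rw [Matrix.map_sub _ (map_sub _), Matrix.map_one _ (map_zero _) (map_one _),
        sub_mulVec, one_mulVec, hxy, sub_self]
    | cast t => rw [h, mulVec_zero]

theorem exists_sliceSum_eq_of_algebraMap [Finite a] [Finite b] [Finite c]
    {z : SliceParam p q s a b c → K} {T : a × b × c → O}
    (h : sliceSum z = algebraMap O K ∘ T) :
    ∃ z' : SliceParam p q s a b c → O, sliceSum z' = T := by
  classical
  cases nonempty_fintype a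
  cases nonempty_fintype b
  cases nonempty_fintype c
  obtain ⟨M₁, N₁, h₁⟩ := exists_map_one_sub_mul_mulVec_eq_zero (O := O)
    fun t i => z (.inl (t, .inl i))
  obtain ⟨M₂, N₂, h₂⟩ := exists_map_one_sub_mul_mulVec_eq_zero (O := O)
    fun t j => z (.inr (.inl (t, .inl j)))
  obtain ⟨M₃, N₃, h₃⟩ := exists_map_one_sub_mul_mulVec_eq_zero (O := O)
    fun t k => z (.inr (.inr (t, .inl k)))
  refine exists_sliceSum_eq_of_contract_eq_zero (M₁ := M₁) (N₁ := N₁) (M₂ := M₂) (N₂ := N₂)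
    (M₃ := M₃) (N₃ := N₃) (funext fun i => ?_)
  refine IsFractionRing.injective O K ?_
  rw [map_contract, ← h, contract_sliceSum_eq_zero h₁ h₂ h₃, Pi.zero_apply, Pi.zero_apply, map_zero]

end ValuationRing

theorem zariskiClosure_range_sliceSum_subset {F : Type*} [Field F] [IsAlgClosed F]
    [Finite a] [Finite b] [Finite c] :
    zariskiClosure F (Set.range (sliceSum : (SliceParam p q s a b c → F) → a × b × c → F)) ⊆
      Set.range (sliceSum : (SliceParam p q s a b c → F) → a × b × c → F) := by
  have range_eq : (Set.range fun (z : SliceParam p q s a b c → F) i =>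
      MvPolynomial.eval z (sliceSum MvPolynomial.X i)) =
      Set.range (sliceSum : (SliceParam p q s a b c → F) → a × b × c → F) :=
    congrArg Set.range (funext fun z => funext fun i => aeval_sliceSum_X z i)
  rw [← range_eq]
  refine zariskiClosure_range_subset_of_valuative _ fun K _ _ O _ _ z y hy => ?_
  obtain ⟨z', hz'⟩ := exists_sliceSum_eq_of_algebraMap (z := z) (T := y)
    (funext fun i => (aeval_sliceSum_X z i).symm.trans (hy i))
  exact ⟨z', fun i => (aeval_sliceSum_X z' i).trans (congrFun hz' i)⟩

end Arrays

section Tensor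

variable {F U V W : Type*} [Field F] [AddCommGroup U] [Module F U]
  [AddCommGroup V] [Module F V] [AddCommGroup W] [Module F W]

/-- `T` is a sum of `p` slices `u ⊗₁ X`, `q` slices `v ⊗₂ Y` and `s` slices `w ⊗₃ Z`: the refinement
of `IsCombOfSlices` that records the number of slices in each of the three directions. -/
def IsSliceSum (p q s : ℕ) (T : U ⊗[F] (V ⊗[F] W)) : Prop :=
  ∃ (u : Fin p → U) (X : Fin p → V ⊗[F] W) (v : Fin q → V) (Y : Fin q → U ⊗[F] W)
    (w : Fin s → W) (Z : Fin s → U ⊗[F] V),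
    T = ∑ t, otimes₁ (u t) (X t) + ∑ t, otimes₂ (v t) (Y t) + ∑ t, otimes₃ (w t) (Z t)

theorem isSliceSum_zero (p q s : ℕ) : IsSliceSum p q s (0 : U ⊗[F] (V ⊗[F] W)) :=
  ⟨0, 0, 0, 0, 0, 0, by simp [otimes₁, otimes₂, otimes₃]⟩

theorem IsSliceSum.add {p q s p' q' s' : ℕ} {T T' : U ⊗[F] (V ⊗[F] W)}
    (h : IsSliceSum p q s T) (h' : IsSliceSum p' q' s' T') :
    IsSliceSum (p + p') (q + q') (s + s') (T + T') := by
  obtain ⟨u, X, v, Y, w, Z, rfl⟩ := h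
  obtain ⟨u', X', v', Y', w', Z', rfl⟩ := h'
  refine ⟨Fin.append u u', Fin.append X X', Fin.append v v', Fin.append Y Y', Fin.append w w',
    Fin.append Z Z', ?_⟩
  simp only [Fin.sum_univ_add, Fin.append_left, Fin.append_right]
  abel

theorem IsSliceSum.smul {p q s : ℕ} {T : U ⊗[F] (V ⊗[F] W)} (a : F) (h : IsSliceSum p q s T) :
    IsSliceSum p q s (a • T) := by
  obtain ⟨u, X, v, Y, w, Z, rfl⟩ := h
  refine ⟨u, a • X, v, a • Y, w, a • Z, ?_⟩
  simp [otimes₁, otimes₂, otimes₃, Finset.smul_sum, smul_add, ← TensorProduct.smul_tmul']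

theorem IsSlice.exists_isSliceSum {T : U ⊗[F] (V ⊗[F] W)} (h : IsSlice T) :
    ∃ ρ : Triple 1, IsSliceSum ρ.r₁ ρ.r₂ ρ.r₃ T := by
  rcases h with ⟨u, x, rfl⟩ | ⟨v, y, rfl⟩ | ⟨w, z, rfl⟩
  · exact ⟨⟨1, 0, 0, rfl⟩, fun _ => u, fun _ => x, 0, 0, 0, 0, by simp⟩
  · exact ⟨⟨0, 1, 0, rfl⟩, 0, 0, fun _ => v, fun _ => y, 0, 0, by simp⟩
  · exact ⟨⟨0, 0, 1, rfl⟩, 0, 0, 0, 0, fun _ => w, fun _ => z, by simp⟩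

theorem IsCombOfSlices.exists_isSliceSum {k : ℕ} {T : U ⊗[F] (V ⊗[F] W)}
    (h : IsCombOfSlices T k) : ∃ ρ : Triple k, IsSliceSum ρ.r₁ ρ.r₂ ρ.r₃ T := by
  induction k generalizing T with
  | zero =>
    obtain ⟨c, t, -, rfl⟩ := h
    exact ⟨⟨0, 0, 0, rfl⟩, by simpa using isSliceSum_zero 0 0 0⟩
  | succ k ih =>
    obtain ⟨c, t, ht, rfl⟩ := h
    obtain ⟨ρ, hρ⟩ := ih ⟨fun i => c i.castSucc, fun i => t i.castSucc, fun i => ht _, rfl⟩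
    obtain ⟨σ, hσ⟩ := (ht (Fin.last k)).exists_isSliceSum
    refine ⟨⟨ρ.r₁ + σ.r₁, ρ.r₂ + σ.r₂, ρ.r₃ + σ.r₃, ?_⟩, ?_⟩
    · have := ρ.sum_eq
      have := σ.sum_eq
      omega
    · rw [Fin.sum_univ_castSucc]
      exact hρ.add (hσ.smul _)

theorem IsSliceSum.isCombOfSlices {p q s : ℕ} {T : U ⊗[F] (V ⊗[F] W)}
    (h : IsSliceSum p q s T) : IsCombOfSlices T (p + q + s) := by
  obtain ⟨u, X, v, Y, w, Z, rfl⟩ := h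
  refine ⟨1, Fin.append (Fin.append (fun t => otimes₁ (u t) (X t))
    (fun t => otimes₂ (v t) (Y t))) (fun t => otimes₃ (w t) (Z t)), fun i => ?_, ?_⟩
  · refine Fin.addCases (fun i => ?_) (fun i => Or.inr (Or.inr ⟨w i, Z i, by simp⟩)) i
    refine Fin.addCases (fun i => ?_) (fun i => Or.inr (Or.inl ⟨v i, Y i, by simp⟩)) i
    exact Or.inl ⟨u i, X i, by simp⟩
  · simp [Fin.sum_univ_add]

theorem sliceRank_le_iff {r : ℕ} {T : U ⊗[F] (V ⊗[F] W)} :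
    sliceRank T ≤ r ↔ ∃ ρ : Triple r, IsSliceSum ρ.r₁ ρ.r₂ ρ.r₃ T := by
  constructor
  · intro h
    have hk : IsCombOfSlices T (sliceRank T) := Nat.sInf_mem (exists_isCombOfSlices T)
    obtain ⟨ρ, hρ⟩ := hk.exists_isSliceSum
    refine ⟨⟨ρ.r₁ + (r - sliceRank T), ρ.r₂, ρ.r₃, ?_⟩, ?_⟩
    · have := ρ.sum_eq
      omega
    · simpa using hρ.add (isSliceSum_zero (r - sliceRank T) 0 0)
  · rintro ⟨ρ, hρ⟩
    exact Nat.sInf_le (ρ.sum_eq ▸ hρ.isCombOfSlices)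

variable {A B C : Type*} [AddCommGroup A] [Module F A]
  [AddCommGroup B] [Module F B] [AddCommGroup C] [Module F C]

theorem map_otimes₂ (f : U →ₗ[F] A) (g : V →ₗ[F] B) (h : W →ₗ[F] C) (v : V) (y : U ⊗[F] W) :
    TensorProduct.map f (TensorProduct.map g h) (otimes₂ v y) =
      otimes₂ (g v) (TensorProduct.map f h y) := by
  induction y with
  | zero => simp [otimes₂]
  | tmul u w => simp [otimes₂]
  | add x y hx hy => simpa [otimes₂, TensorProduct.tmul_add] using congrArg₂ (· + ·) hx hy

theorem map_otimes₃ (f : U →ₗ[F] A) (g : V →ₗ[F] B) (h : W →ₗ[F] C) (w : W) (z : U ⊗[F] V) :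
    TensorProduct.map f (TensorProduct.map g h) (otimes₃ w z) =
      otimes₃ (h w) (TensorProduct.map f g z) := by
  induction z with
  | zero => simp [otimes₃]
  | tmul u w => simp [otimes₃]
  | add x y hx hy => simpa [otimes₃, TensorProduct.add_tmul] using congrArg₂ (· + ·) hx hy

theorem IsSliceSum.map {p q s : ℕ} {T : U ⊗[F] (V ⊗[F] W)} (hT : IsSliceSum p q s T)
    (f : U →ₗ[F] A) (g : V →ₗ[F] B) (h : W →ₗ[F] C) :
    IsSliceSum p q s (TensorProduct.map f (TensorProduct.map g h) T) := by
  obtain ⟨u, X, v, Y, w, Z, rfl⟩ := hT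
  refine ⟨fun t => f (u t), fun t => TensorProduct.map g h (X t), fun t => g (v t),
    fun t => TensorProduct.map f h (Y t), fun t => h (w t),
    fun t => TensorProduct.map f g (Z t), ?_⟩
  simp only [map_add, map_sum, map_otimes₂, map_otimes₃]
  simp only [otimes₁, TensorProduct.map_tmul]

theorem map_map_of_comp_eq_id {f : U →ₗ[F] A} {f' : A →ₗ[F] U} {g : V →ₗ[F] B} {g' : B →ₗ[F] V}
    {h : W →ₗ[F] C} {h' : C →ₗ[F] W} (hf : f' ∘ₗ f = .id) (hg : g' ∘ₗ g = .id)
    (hh : h' ∘ₗ h = .id) (T : U ⊗[F] (V ⊗[F] W)) :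
    TensorProduct.map f' (TensorProduct.map g' h')
      (TensorProduct.map f (TensorProduct.map g h) T) = T := by
  rw [← LinearMap.comp_apply, ← TensorProduct.map_comp, ← TensorProduct.map_comp, hf, hg, hh,
    TensorProduct.map_id, TensorProduct.map_id, LinearMap.id_apply]

theorem otimes₁_sum_tmul {ι : Type*} [Fintype ι] (u : U) (x : ι → V) (y : ι → W) :
    otimes₁ u (∑ j, x j ⊗ₜ[F] y j) = ∑ j, u ⊗ₜ[F] (x j ⊗ₜ[F] y j) := by
  rw [otimes₁, TensorProduct.tmul_sum]

theorem otimes₂_sum_tmul {ι : Type*} [Fintype ι] (v : V) (x : ι → U) (y : ι → W) :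
    otimes₂ v (∑ j, x j ⊗ₜ[F] y j) = ∑ j, x j ⊗ₜ[F] (v ⊗ₜ[F] y j) := by
  simp [otimes₂, TensorProduct.tmul_sum]

theorem otimes₃_sum_tmul {ι : Type*} [Fintype ι] (w : W) (x : ι → U) (y : ι → V) :
    otimes₃ w (∑ j, x j ⊗ₜ[F] y j) = ∑ j, x j ⊗ₜ[F] (y j ⊗ₜ[F] w) := by
  simp [otimes₃, TensorProduct.sum_tmul]

theorem isSliceSum_unitTensor (n : ℕ) {r : ℕ} (ρ : Triple r) :
    IsSliceSum ρ.r₁ ρ.r₂ ρ.r₃ (unitTensor F n ρ) := by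
  refine ⟨fun i => e F (.inl i), fun i => ∑ j : Fin n, e F (.inl (i, j)) ⊗ₜ e F (.inl (i, j)),
    fun i => e F (.inr (.inl i)),
    fun i => ∑ j : Fin n, e F (.inr (.inl (i, j))) ⊗ₜ e F (.inr (.inl (i, j))),
    fun i => e F (.inr (.inr i)),
    fun i => ∑ j : Fin n, e F (.inr (.inr (i, j))) ⊗ₜ e F (.inr (.inr (i, j))), ?_⟩
  simp only [unitTensor, otimes₁_sum_tmul, otimes₂_sum_tmul, otimes₃_sum_tmul]

section Basis

variable {a b c : Type*}
  (bU : Module.Basis a F U) (bV : Module.Basis b F V) (bW : Module.Basis c F W)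

theorem repr_otimes₁ (u : U) (x : V ⊗[F] W) (i : a) (j : b) (k : c) :
    (bU.tensorProduct (bV.tensorProduct bW)).repr (otimes₁ u x) (i, j, k) =
      bU.repr u i * (bV.tensorProduct bW).repr x (j, k) := by
  simp [otimes₁, mul_comm]

theorem repr_otimes₂ (v : V) (y : U ⊗[F] W) (i : a) (j : b) (k : c) :
    (bU.tensorProduct (bV.tensorProduct bW)).repr (otimes₂ v y) (i, j, k) =
      bV.repr v j * (bU.tensorProduct bW).repr y (i, k) := by
  induction y with
  | zero => simp [otimes₂]
  | tmul u w => simp [otimes₂, mul_left_comm, mul_comm]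
  | add x y hx hy =>
    simpa [otimes₂, TensorProduct.tmul_add, mul_add] using congrArg₂ (· + ·) hx hy

theorem repr_otimes₃ (w : W) (z : U ⊗[F] V) (i : a) (j : b) (k : c) :
    (bU.tensorProduct (bV.tensorProduct bW)).repr (otimes₃ w z) (i, j, k) =
      bW.repr w k * (bU.tensorProduct bV).repr z (i, j) := by
  induction z with
  | zero => simp [otimes₃]
  | tmul u v =>
    simp only [otimes₃, TensorProduct.assoc_tmul, Module.Basis.tensorProduct_repr_tmul_apply,
      smul_eq_mul]
    ring
  | add x y hx hy =>
    simpa [otimes₃, TensorProduct.add_tmul, mul_add] using congrArg₂ (· + ·) hx hy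

theorem isSliceSum_iff_equivFun_mem_range [Finite a] [Finite b] [Finite c] {p q s : ℕ}
    {T : U ⊗[F] (V ⊗[F] W)} :
    IsSliceSum p q s T ↔ (bU.tensorProduct (bV.tensorProduct bW)).equivFun T ∈
      Set.range (sliceSum : (SliceParam p q s a b c → F) → a × b × c → F) := by
  constructor
  · rintro ⟨u, X, v, Y, w, Z, rfl⟩
    refine ⟨fun
      | .inl (t, .inl i) => bU.repr (u t) i
      | .inl (t, .inr jk) => (bV.tensorProduct bW).repr (X t) jk
      | .inr (.inl (t, .inl j)) => bV.repr (v t) j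
      | .inr (.inl (t, .inr ik)) => (bU.tensorProduct bW).repr (Y t) ik
      | .inr (.inr (t, .inl k)) => bW.repr (w t) k
      | .inr (.inr (t, .inr ij)) => (bU.tensorProduct bV).repr (Z t) ij, ?_⟩
    funext ⟨i, j, k⟩
    rw [Module.Basis.equivFun_apply]
    simp only [map_add, map_sum, Finsupp.add_apply,
      Finsupp.finsetSum_apply, repr_otimes₁, repr_otimes₂, repr_otimes₃, sliceSum]
  · rintro ⟨z, hz⟩
    refine ⟨fun t => bU.equivFun.symm fun i => z (.inl (t, .inl i)),
      fun t => (bV.tensorProduct bW).equivFun.symm fun jk => z (.inl (t, .inr jk)),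
      fun t => bV.equivFun.symm fun j => z (.inr (.inl (t, .inl j))),
      fun t => (bU.tensorProduct bW).equivFun.symm fun ik => z (.inr (.inl (t, .inr ik))),
      fun t => bW.equivFun.symm fun k => z (.inr (.inr (t, .inl k))),
      fun t => (bU.tensorProduct bV).equivFun.symm fun ij => z (.inr (.inr (t, .inr ij))), ?_⟩
    refine (bU.tensorProduct (bV.tensorProduct bW)).ext_elem fun ⟨i, j, k⟩ => ?_
    rw [← Module.Basis.equivFun_apply, ← hz]
    simp only [map_add, map_sum, Finsupp.add_apply, Finsupp.finsetSum_apply, repr_otimes₁,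
      repr_otimes₂, repr_otimes₃, sliceSum, ← Module.Basis.equivFun_apply,
      LinearEquiv.apply_symm_apply]

end Basis

theorem exists_finite_submodule_mem_range_map (T : U ⊗[F] (V ⊗[F] W)) :
    ∃ (U₀ : Submodule F U) (V₀ : Submodule F V) (W₀ : Submodule F W),
      Module.Finite F U₀ ∧ Module.Finite F V₀ ∧ Module.Finite F W₀ ∧
        T ∈ LinearMap.range
          (TensorProduct.map U₀.subtype (TensorProduct.map V₀.subtype W₀.subtype)) := by
  obtain ⟨U₀, X₀, hU₀, hX₀, hT⟩ :=
    TensorProduct.exists_finite_submodule_of_setFinite {T} (Set.finite_singleton T)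
  obtain ⟨X, rfl⟩ := Module.Finite.iff_fg.mp hX₀
  obtain ⟨V₀, W₀, hV₀, hW₀, hX⟩ :=
    TensorProduct.exists_finite_submodule_of_setFinite (X : Set (V ⊗[F] W)) X.finite_toSet
  refine ⟨U₀, V₀, W₀, hU₀, hV₀, hW₀, TensorProduct.range_map_mono le_rfl ?_ (hT rfl)⟩
  rwa [Submodule.range_subtype, Submodule.span_le]

theorem isSliceSum_of_mem_zariskiClosure_of_finite [IsAlgClosed F] [FiniteDimensional F U]
    [FiniteDimensional F V] [FiniteDimensional F W] {p q s : ℕ} {T : U ⊗[F] (V ⊗[F] W)}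
    (hT : T ∈ zariskiClosure F {T' : U ⊗[F] (V ⊗[F] W) | IsSliceSum p q s T'}) :
    IsSliceSum p q s T := by
  let bU := Module.finBasis F U
  let bV := Module.finBasis F V
  let bW := Module.finBasis F W
  rw [isSliceSum_iff_equivFun_mem_range bU bV bW]
  refine zariskiClosure_range_sliceSum_subset (zariskiClosure_mono ?_ (map_mem_zariskiClosure_image
    (bU.tensorProduct (bV.tensorProduct bW)).equivFun.toLinearMap hT))
  rintro _ ⟨T', hT', rfl⟩
  exact (isSliceSum_iff_equivFun_mem_range bU bV bW).mp hT'

theorem isSliceSum_of_mem_zariskiClosure [IsAlgClosed F] {p q s : ℕ} {T : U ⊗[F] (V ⊗[F] W)}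
    (hT : T ∈ zariskiClosure F {T' : U ⊗[F] (V ⊗[F] W) | IsSliceSum p q s T'}) :
    IsSliceSum p q s T := by
  obtain ⟨U₀, V₀, W₀, _, _, _, T₀, rfl⟩ := exists_finite_submodule_mem_range_map T
  refine IsSliceSum.map (isSliceSum_of_mem_zariskiClosure_of_finite ?_) _ _ _
  obtain ⟨f, hf⟩ := U₀.subtype.exists_leftInverse_of_injective U₀.ker_subtype
  obtain ⟨g, hg⟩ := V₀.subtype.exists_leftInverse_of_injective V₀.ker_subtype
  obtain ⟨h, hh⟩ := W₀.subtype.exists_leftInverse_of_injective W₀.ker_subtype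
  have hT₀ := map_mem_zariskiClosure_image (TensorProduct.map f (TensorProduct.map g h)) hT
  rw [map_map_of_comp_eq_id hf hg hh] at hT₀
  refine zariskiClosure_mono ?_ hT₀
  rintro _ ⟨T', hT', rfl⟩
  exact IsSliceSum.map hT' f g h

end Tensor

section SpanningFamily

variable {F V W : Type*} [Field F] [AddCommGroup V] [Module F V] [AddCommGroup W] [Module F W]

theorem exists_span_range_eq_top_of_finrank_le [FiniteDimensional F V] {n : ℕ}
    (hn : Module.finrank F V ≤ n) : ∃ b : Fin n → V, Submodule.span F (Set.range b) = ⊤ := by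
  refine ⟨Function.extend (Fin.castLE hn) (Module.finBasis F V) 0, top_le_iff.mp ?_⟩
  rw [Set.range_extend (Fin.castLE_injective hn), ← (Module.finBasis F V).span_eq]
  exact Submodule.span_mono Set.subset_union_left

theorem exists_eq_sum_tmul_of_span_eq_top {ι : Type*} [Fintype ι] {b : ι → V}
    (hb : Submodule.span F (Set.range b) = ⊤) (x : V ⊗[F] W) :
    ∃ y : ι → W, x = ∑ j, b j ⊗ₜ[F] y j := by
  induction x with
  | zero => exact ⟨0, by simp⟩
  | tmul v w =>
    obtain ⟨c, rfl⟩ :=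
      (Submodule.mem_span_range_iff_exists_fun F).mp (hb ▸ Submodule.mem_top (x := v))
    exact ⟨fun j => c j • w, by simp only [TensorProduct.sum_tmul, TensorProduct.smul_tmul]⟩
  | add x x' hx hx' =>
    obtain ⟨y, rfl⟩ := hx
    obtain ⟨y', rfl⟩ := hx'
    exact ⟨y + y', by simp only [Pi.add_apply, TensorProduct.tmul_add, Finset.sum_add_distrib]⟩

theorem exists_linearMap_apply_e {ι : Type*} [Finite ι] [DecidableEq ι] (x : ι → V) :
    ∃ f : (ι → F) →ₗ[F] V, ∀ i, f (e F i) = x i :=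
  ⟨(Pi.basisFun F ι).constr F x, fun i => by
    rw [e, ← Pi.basisFun_apply, Module.Basis.constr_basis]⟩

end SpanningFamily

section Spectrum

variable {F M A : Type*} [Field F] [AddCommGroup M] [Module F M] [AddCommGroup A] [Module F A]

theorem isUnit_algebraMap_sub_comp {i : M →ₗ[F] A} {π : A →ₗ[F] M} {c : F} (hc : c ≠ 0)
    (h : IsUnit (algebraMap F (Module.End F M) c - π ∘ₗ i)) :
    IsUnit (algebraMap F (Module.End F A) c - i ∘ₗ π) := by
  obtain ⟨hinj, hsurj⟩ := (Module.End.isUnit_iff _).mp h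
  refine (Module.End.isUnit_iff _).mpr ⟨(injective_iff_map_eq_zero _).mpr fun x hx => ?_,
    fun y => ?_⟩
  · have hx' : c • x = i (π x) := by simpa [sub_eq_zero] using hx
    have hπ : π x = 0 := (injective_iff_map_eq_zero _).mp hinj _ (by simp [← hx'])
    simpa [hπ, hc] using hx'
  · obtain ⟨z, hz⟩ := hsurj (π y)
    have hz' : π y + π (i z) = c • z := by simp [← hz]
    have hπ : π (c⁻¹ • (y + i z)) = z := by rw [map_smul, map_add, hz', inv_smul_smul₀ hc]
    -- The inverse of `c - i π` is `c⁻¹ (1 + i (c - π i)⁻¹ π)`.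
    refine ⟨c⁻¹ • (y + i z), ?_⟩
    rw [LinearMap.sub_apply, LinearMap.comp_apply, hπ, Module.algebraMap_end_apply,
      smul_inv_smul₀ hc, add_sub_cancel_right]

theorem finite_spectrum_comp [FiniteDimensional F M] (i : M →ₗ[F] A) (π : A →ₗ[F] M) :
    (spectrum F (i ∘ₗ π)).Finite := by
  refine ((Module.End.finite_spectrum (π ∘ₗ i)).insert 0).subset fun c hc => ?_
  rw [Set.mem_insert_iff, or_iff_not_imp_left]
  exact fun hc₀ h => hc (isUnit_algebraMap_sub_comp hc₀ h)

end Spectrum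

section Orbit

variable {F A B C : Type*} [Field F] [AddCommGroup A] [Module F A]
  [AddCommGroup B] [Module F B] [AddCommGroup C] [Module F C]

theorem map_mem_zariskiClosure_of_forall_units {R M : Type*} [Infinite F] [Ring R] [Algebra F R]
    [AddCommGroup M] [Module F M] {X : Set M} (L : R →ₗ[F] M) {a : R}
    (ha : (spectrum F a).Finite) (h : ∀ u : Rˣ, L u ∈ zariskiClosure F X) :
    L a ∈ zariskiClosure F X := by
  -- `a - t` is a unit for all `t` outside the spectrum of `a`.
  refine mem_zariskiClosure_of_infinite_line (y := -L 1) (ha.infinite_compl.mono fun t ht => ?_)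
  obtain ⟨u, hu⟩ := (spectrum.notMem_iff.mp ht).neg
  have hLu := h u
  rwa [hu, neg_sub, Algebra.algebraMap_eq_smul_one, map_sub, map_smul, sub_eq_add_neg,
    ← smul_neg] at hLu

theorem map_mem_zariskiClosure_orbit [Infinite F] {f : Module.End F A} {g : Module.End F B}
    {h : Module.End F C} (hf : (spectrum F f).Finite) (hg : (spectrum F g).Finite)
    (hh : (spectrum F h).Finite) (T : A ⊗[F] (B ⊗[F] C)) :
    TensorProduct.map f (TensorProduct.map g h) T ∈ zariskiClosure F (orbit T) := by
  let evalT : (A ⊗[F] (B ⊗[F] C) →ₗ[F] A ⊗[F] (B ⊗[F] C)) →ₗ[F] A ⊗[F] (B ⊗[F] C) :=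
    LinearMap.applyₗ T
  let mapA := TensorProduct.mapBilinear (.id F) A (B ⊗[F] C) A (B ⊗[F] C)
  let mapB := TensorProduct.mapBilinear (.id F) B C B C
  refine map_mem_zariskiClosure_of_forall_units
    (evalT ∘ₗ mapA.flip (TensorProduct.map g h)) hf fun a => ?_
  refine map_mem_zariskiClosure_of_forall_units (evalT ∘ₗ mapA a ∘ₗ mapB.flip h) hg fun b => ?_
  refine map_mem_zariskiClosure_of_forall_units (evalT ∘ₗ mapA a ∘ₗ mapB b) hh fun c => ?_
  exact subset_zariskiClosure ⟨a, b, c, rfl⟩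

end Orbit

section UnitTensor

variable {F U V W A B C : Type*} [Field F] [AddCommGroup U] [Module F U]
  [AddCommGroup V] [Module F V] [AddCommGroup W] [Module F W] [AddCommGroup A] [Module F A]
  [AddCommGroup B] [Module F B] [AddCommGroup C] [Module F C] {n r : ℕ} {ρ : Triple r}

theorem IsSliceSum.exists_map_unitTensor {bU : Fin n → U} {bV : Fin n → V}
    (hbU : Submodule.span F (Set.range bU) = ⊤) (hbV : Submodule.span F (Set.range bV) = ⊤)
    {T : U ⊗[F] (V ⊗[F] W)} (hT : IsSliceSum ρ.r₁ ρ.r₂ ρ.r₃ T) :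
    ∃ (f : U' F n ρ →ₗ[F] U) (g : V' F n ρ →ₗ[F] V) (h : W' F n ρ →ₗ[F] W),
      TensorProduct.map f (TensorProduct.map g h) (unitTensor F n ρ) = T := by
  obtain ⟨u, X, v, Y, w, Z, rfl⟩ := hT
  choose x hx using fun t => exists_eq_sum_tmul_of_span_eq_top hbV (X t)
  choose y hy using fun t => exists_eq_sum_tmul_of_span_eq_top hbU (Y t)
  choose z hz using fun t => exists_eq_sum_tmul_of_span_eq_top hbU (Z t)
  obtain ⟨f, hf⟩ := exists_linearMap_apply_e (F := F) (Sum.elim u (Sum.elim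
    (fun i : Fin ρ.r₂ × Fin n => bU i.2) (fun i : Fin ρ.r₃ × Fin n => bU i.2)))
  obtain ⟨g, hg⟩ := exists_linearMap_apply_e (F := F) (Sum.elim
    (fun i : Fin ρ.r₁ × Fin n => bV i.2) (Sum.elim v (fun i : Fin ρ.r₃ × Fin n => z i.1 i.2)))
  obtain ⟨h, hh⟩ := exists_linearMap_apply_e (F := F) (Sum.elim
    (fun i : Fin ρ.r₁ × Fin n => x i.1 i.2)
    (Sum.elim (fun i : Fin ρ.r₂ × Fin n => y i.1 i.2) w))
  refine ⟨f, g, h, ?_⟩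
  simp only [unitTensor, map_add, map_sum, TensorProduct.map_tmul, hf, hg, hh, Sum.elim_inl,
    Sum.elim_inr, hx, hy, hz, otimes₁_sum_tmul, otimes₂_sum_tmul, otimes₃_sum_tmul]

theorem map_unitTensor_mem_zariskiClosure_orbit [Infinite F] {α : U' F n ρ →ₗ[F] A}
    {β : V' F n ρ →ₗ[F] B} {γ : W' F n ρ →ₗ[F] C} (hα : Function.Injective α)
    (hβ : Function.Injective β) (hγ : Function.Injective γ) (f : U' F n ρ →ₗ[F] A)
    (g : V' F n ρ →ₗ[F] B) (h : W' F n ρ →ₗ[F] C) :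
    TensorProduct.map f (TensorProduct.map g h) (unitTensor F n ρ) ∈
      zariskiClosure F (orbit
        (TensorProduct.map α (TensorProduct.map β γ) (unitTensor F n ρ))) := by
  obtain ⟨α', hα'⟩ := α.exists_leftInverse_of_injective (LinearMap.ker_eq_bot.mpr hα)
  obtain ⟨β', hβ'⟩ := β.exists_leftInverse_of_injective (LinearMap.ker_eq_bot.mpr hβ)
  obtain ⟨γ', hγ'⟩ := γ.exists_leftInverse_of_injective (LinearMap.ker_eq_bot.mpr hγ)
  have := map_mem_zariskiClosure_orbit (finite_spectrum_comp f α') (finite_spectrum_comp g β')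
    (finite_spectrum_comp h γ') (TensorProduct.map α (TensorProduct.map β γ) (unitTensor F n ρ))
  rwa [TensorProduct.map_comp, TensorProduct.map_comp, LinearMap.comp_apply,
    map_map_of_comp_eq_id hα' hβ' hγ'] at this

theorem isSliceSum_of_mem_zariskiClosure_orbit_unitTensor [IsAlgClosed F]
    {α : U' F n ρ →ₗ[F] A} {β : V' F n ρ →ₗ[F] B} {γ : W' F n ρ →ₗ[F] C} {T : A ⊗[F] (B ⊗[F] C)}
    (hT : T ∈ zariskiClosure F (orbit
      (TensorProduct.map α (TensorProduct.map β γ) (unitTensor F n ρ)))) :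
    IsSliceSum ρ.r₁ ρ.r₂ ρ.r₃ T := by
  refine isSliceSum_of_mem_zariskiClosure (zariskiClosure_mono ?_ hT)
  rintro T' ⟨a, b, c, hT'⟩
  rw [Set.mem_ofPred_eq, hT']
  exact ((isSliceSum_unitTensor n ρ).map α β γ).map (a : A →ₗ[F] A) (b : B →ₗ[F] B) (c : C →ₗ[F] C)

theorem map_mem_zariskiClosure_orbit_unitTensor_iff [IsAlgClosed F] [FiniteDimensional F U]
    [FiniteDimensional F V] (hU : Module.finrank F U ≤ n) (hV : Module.finrank F V ≤ n)
    {α : U' F n ρ →ₗ[F] A} {β : V' F n ρ →ₗ[F] B} {γ : W' F n ρ →ₗ[F] C}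
    (hα : Function.Injective α) (hβ : Function.Injective β) (hγ : Function.Injective γ)
    {f : U →ₗ[F] A} {g : V →ₗ[F] B} {h : W →ₗ[F] C} (hf : Function.Injective f)
    (hg : Function.Injective g) (hh : Function.Injective h) {T : U ⊗[F] (V ⊗[F] W)} :
    TensorProduct.map f (TensorProduct.map g h) T ∈ zariskiClosure F (orbit
      (TensorProduct.map α (TensorProduct.map β γ) (unitTensor F n ρ))) ↔
        IsSliceSum ρ.r₁ ρ.r₂ ρ.r₃ T := by
  refine ⟨fun hT => ?_, fun hT => ?_⟩
  · obtain ⟨f', hf'⟩ := f.exists_leftInverse_of_injective (LinearMap.ker_eq_bot.mpr hf)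
    obtain ⟨g', hg'⟩ := g.exists_leftInverse_of_injective (LinearMap.ker_eq_bot.mpr hg)
    obtain ⟨h', hh'⟩ := h.exists_leftInverse_of_injective (LinearMap.ker_eq_bot.mpr hh)
    have := (isSliceSum_of_mem_zariskiClosure_orbit_unitTensor hT).map f' g' h'
    rwa [map_map_of_comp_eq_id hf' hg' hh'] at this
  · obtain ⟨bU, hbU⟩ := exists_span_range_eq_top_of_finrank_le hU
    obtain ⟨bV, hbV⟩ := exists_span_range_eq_top_of_finrank_le hV
    obtain ⟨a, b, c, rfl⟩ := hT.exists_map_unitTensor hbU hbV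
    have := map_unitTensor_mem_zariskiClosure_orbit hα hβ hγ (f ∘ₗ a) (g ∘ₗ b) (h ∘ₗ c)
    rwa [TensorProduct.map_comp, TensorProduct.map_comp, LinearMap.comp_apply] at this

end UnitTensor

end SliceRank

open SliceRank in
theorem mainTheorem5_general {F : Type*} [Field F] [IsAlgClosed F] (n r : ℕ)
    {U V W : Type*} [AddCommGroup U] [Module F U] [FiniteDimensional F U]
    [AddCommGroup V] [Module F V] [FiniteDimensional F V] [AddCommGroup W] [Module F W]
    (hU : Module.finrank F U ≤ n) (hV : Module.finrank F V ≤ n)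
    {A B C : Triple r → Type*} [∀ ρ, AddCommGroup (A ρ)] [∀ ρ, Module F (A ρ)]
    [∀ ρ, AddCommGroup (B ρ)] [∀ ρ, Module F (B ρ)] [∀ ρ, AddCommGroup (C ρ)] [∀ ρ, Module F (C ρ)]
    (α : ∀ ρ, U' F n ρ →ₗ[F] A ρ) (hα : ∀ ρ, Function.Injective (α ρ))
    (β : ∀ ρ, V' F n ρ →ₗ[F] B ρ) (hβ : ∀ ρ, Function.Injective (β ρ))
    (γ : ∀ ρ, W' F n ρ →ₗ[F] C ρ) (hγ : ∀ ρ, Function.Injective (γ ρ))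
    (f : ∀ ρ, U →ₗ[F] A ρ) (hf : ∀ ρ, Function.Injective (f ρ))
    (g : ∀ ρ, V →ₗ[F] B ρ) (hg : ∀ ρ, Function.Injective (g ρ))
    (h : ∀ ρ, W →ₗ[F] C ρ) (hh : ∀ ρ, Function.Injective (h ρ)) :
    sliceRankVariety F U V W r =
      ⋃ ρ : Triple r, TensorProduct.map (f ρ) (TensorProduct.map (g ρ) (h ρ)) ⁻¹'
        zariskiClosure F (orbit
          (TensorProduct.map (α ρ) (TensorProduct.map (β ρ) (γ ρ)) (unitTensor F n ρ))) := by
  ext T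
  rw [sliceRankVariety, Set.mem_ofPred_eq, sliceRank_le_iff, Set.mem_iUnion]
  exact exists_congr fun ρ => (map_mem_zariskiClosure_orbit_unitTensor_iff hU hV
    (hα ρ) (hβ ρ) (hγ ρ) (hf ρ) (hg ρ) (hh ρ)).symm

/-- For each `ρ = (r₁, r₂, r₃)` the spaces `U'`, `V'`, `W'` sit in `A ρ`, `B ρ`, `C ρ` via `α`, `β`,
`γ` (with `A ρ = U'`, `B ρ = V'`, `C ρ = W'` and the identity maps allowed, in which case the group
is `GL_{s₁} × GL_{s₂} × GL_{s₃}`), and `U`, `V`, `W` sit in them via `f`, `g`, `h`; intersecting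
with `U ⊗ V ⊗ W` is taking the preimage under `f ⊗ g ⊗ h`. -/
theorem mainTheorem5 {F : Type*} [Field F] [IsAlgClosed F] (n r : ℕ)
    {U V W : Type*} [AddCommGroup U] [Module F U] [FiniteDimensional F U]
    [AddCommGroup V] [Module F V] [FiniteDimensional F V]
    [AddCommGroup W] [Module F W] [FiniteDimensional F W]
    (hU : Module.finrank F U = n) (hV : Module.finrank F V = n) (hW : Module.finrank F W = n)
    {A B C : SliceRank.Triple r → Type*}
    [∀ ρ, AddCommGroup (A ρ)] [∀ ρ, Module F (A ρ)] [∀ ρ, FiniteDimensional F (A ρ)]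
    [∀ ρ, AddCommGroup (B ρ)] [∀ ρ, Module F (B ρ)] [∀ ρ, FiniteDimensional F (B ρ)]
    [∀ ρ, AddCommGroup (C ρ)] [∀ ρ, Module F (C ρ)] [∀ ρ, FiniteDimensional F (C ρ)]
    (α : ∀ ρ, SliceRank.U' F n ρ →ₗ[F] A ρ) (hα : ∀ ρ, Function.Injective (α ρ))
    (β : ∀ ρ, SliceRank.V' F n ρ →ₗ[F] B ρ) (hβ : ∀ ρ, Function.Injective (β ρ))
    (γ : ∀ ρ, SliceRank.W' F n ρ →ₗ[F] C ρ) (hγ : ∀ ρ, Function.Injective (γ ρ))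
    (f : ∀ ρ, U →ₗ[F] A ρ) (hf : ∀ ρ, Function.Injective (f ρ))
    (g : ∀ ρ, V →ₗ[F] B ρ) (hg : ∀ ρ, Function.Injective (g ρ))
    (h : ∀ ρ, W →ₗ[F] C ρ) (hh : ∀ ρ, Function.Injective (h ρ)) :
    SliceRank.sliceRankVariety F U V W r =
      ⋃ ρ : SliceRank.Triple r,
        TensorProduct.map (f ρ) (TensorProduct.map (g ρ) (h ρ)) ⁻¹'
          SliceRank.zariskiClosure F (SliceRank.orbit
            (TensorProduct.map (α ρ) (TensorProduct.map (β ρ) (γ ρ))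
              (SliceRank.unitTensor F n ρ))) := by
  exact mainTheorem5_general n r hU.le hV.le α hα β hβ γ hγ f hf g hg h hh
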